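/- Let $\Phi$ be a finite irreducible reduced crystallographic root system spanning a real vector space $E$, let $(\cdot,\cdot)$ be a scalar product on $E$ invariant under the Weyl group $W$ of $\Phi$, and let $\mathcal P_\Phi$ be the convex hull of $\Phi$. Let $\Pi=\{\alpha_1,\dots,\alpha_n\}$ be a base of $\Phi$, let $\breve\omega_1,\dots,\breve\omega_n\in E$ be the dual basis of $\Pi$ (that is, $(\alpha_i,\breve\omega_j)=\delta_{ij}$), and let $\theta=\sum_i m_i\alpha_i$ be the highest root. Let $\widehat\Phi=\{\alpha+k\delta\mid\alpha\in\Phi,\ k\in\mathbb Z\}\subset E\oplus\mathbb R\delta$ be the affine root system of $\Phi$, where the form of $E$ is extended to $E\oplus\mathbb R\delta$ with kernel $\mathbb R\delta$, let $\alpha_0=-\theta+\delta$ and $\widehat\Pi=\{\alpha_0\}\cup\Pi$, and for $\Gamma\subseteq\widehat\Pi$ let $\widehat\Phi(\Gamma)$ be the root subsystem of $\widehat\Phi$ generated by $\Gamma$. A root subsystem is irreducible if it is nonempty and is not the union of two nonempty mutually orthogonal subsets. Let $J=\{i\in[n]\mid \widehat\Phi(\widehat\Pi\setminus\{\alpha_i\})\text{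 is irreducible}\}$, and for each $i\in J$ let $L_i\subseteq W$ be any complete set of representatives of the left cosets of $W$ modulo the subgroup $W\langle\Pi\setminus\{\alpha_i\}\rangle$ generated by the reflections in the simple roots other than $\alpha_i$. Then $$\mathcal P_\Phi=\{x\in E\mid (x,w\breve\omega_i)\le m_i\ \text{ for all } w\in W,\ i\in[n]\}=\{x\in E\mid (x,w\breve\omega_i)\le m_i\ \text{ for all } i\in J,\ w\in L_i\}.$$ Moreover, the second description is the minimal one: if any one of the inequalities indexed by the pairs $(i,w)$ with $i\in J$, $w\in L_i$ is removed, the remaining ones no longer define $\mathcal P_\Phi$; and every finite set of closed half-spaces of $E$ with intersection $\mathcal P_\Phi$ contains all the half-spaces $\{x\in E\mid (x,w\breve\omega_i)\le m_i\}$ with $i\in J$, $w\in L_i$. -/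

import Mathlib

open scoped InnerProductSpace

noncomputable section

namespace RootPolytope

section HighestRoot

variable {ι E N : Type*} [AddCommGroup E] [Module ℝ E] [AddCommGroup N] [Module ℝ N]
  {P : RootPairing ι ℝ E N}

/-- The root with index `θ` is the highest root with respect to the base `b`: it is the maximum
of the set of roots for the order in which `x ≤ y` means that `y - x` is a combination of simple
roots with natural coefficients. -/
def IsHighestRoot (b : P.Base) (θ : ι) : Prop :=
  ∀ j : ι, P.root θ - P.root j ∈ AddSubmonoid.closure (P.root '' b.support)

/-- An irreducible crystallographic root system has a highest root. -/
theorem exists_isHighestRoot [Finite ι] [P.IsRootSystem] [P.IsCrystallographic] [P.IsReduced]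
    [P.IsIrreducible] (b : P.Base) : ∃ θ : ι, IsHighestRoot b θ := by
  classical
  have hne : Nonempty ι := by
    by_contra h
    rw [not_nonempty_iff] at h
    have h1 : Nontrivial E := RootPairing.IsIrreducible.nontrivial P
    have h2 := RootPairing.IsRootSystem.span_root_eq_top (P := P)
    rw [Set.range_eq_empty, Submodule.span_empty] at h2
    exact bot_ne_top h2
  obtain ⟨θ, hθ⟩ := Finite.exists_max b.height
  have hpos : ∀ i, b.IsPos i → P.root i ∈ AddSubmonoid.closure (P.root '' b.support) := by
    intro i hi
    refine hi.induction_on_add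
      (p := fun i ↦ P.root i ∈ AddSubmonoid.closure (P.root '' b.support))
      (fun i hi ↦ AddSubmonoid.subset_closure ⟨i, hi, rfl⟩) ?_
    intro i j k hk hi hj
    rw [hk]
    exact add_mem hi (AddSubmonoid.subset_closure ⟨j, hj, rfl⟩)
  obtain ⟨i₀, hi₀⟩ := b.support_nonempty
  have hθpos : b.IsPos θ := by
    have h1 := hθ i₀
    rw [RootPairing.Base.height_one_of_mem_support hi₀] at h1
    rw [RootPairing.Base.isPos_iff]
    lia
  have hθC := hpos θ hθpos
  refine ⟨θ, ?_⟩
  by_contra hcon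
  rw [IsHighestRoot, not_forall] at hcon
  have hsub : Nonempty
      {j : ι // P.root θ - P.root j ∉ AddSubmonoid.closure (P.root '' b.support)} :=
    ⟨⟨hcon.choose, hcon.choose_spec⟩⟩
  obtain ⟨⟨j, hj⟩, hjmax⟩ := Finite.exists_max
    (fun x : {j : ι // P.root θ - P.root j ∉ AddSubmonoid.closure (P.root '' b.support)} ↦
      b.height x.1)
  have hjmax' : ∀ k, b.height j < b.height k →
      P.root θ - P.root k ∈ AddSubmonoid.closure (P.root '' b.support) := by
    intro k hk
    by_contra h
    exact absurd (hjmax ⟨k, h⟩) (not_le.mpr hk)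
  have hdomj : ∀ i ∈ b.support, 0 ≤ P.pairingIn ℤ j i := by
    intro i hi
    by_contra h
    push Not at h
    by_cases hij : P.root j = -P.root i
    · exact hj (by
        rw [hij, sub_neg_eq_add]
        exact add_mem hθC (AddSubmonoid.subset_closure ⟨i, hi, rfl⟩))
    · obtain ⟨k, hk⟩ := P.root_add_root_mem_of_pairingIn_neg h hij
      have hh := b.height_add hk
      rw [RootPairing.Base.height_one_of_mem_support hi] at hh
      have h1 := hjmax' k (by lia)
      apply hj
      have h2 : P.root θ - P.root j = (P.root θ - P.root k) + P.root i := by rw [hk]; abel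
      rw [h2]
      exact add_mem h1 (AddSubmonoid.subset_closure ⟨i, hi, rfl⟩)
  have hdomθ : ∀ i ∈ b.support, 0 ≤ P.pairingIn ℤ θ i := by
    intro i hi
    by_contra h
    push Not at h
    by_cases hij : P.root θ = -P.root i
    · have := b.height_add_zsmul (i := θ) (j := i) (k := i) (z := 2) (by rw [hij]; module)
      rw [RootPairing.Base.height_one_of_mem_support hi] at this
      rw [RootPairing.Base.isPos_iff] at hθpos
      simp at this
      lia
    · obtain ⟨k, hk⟩ := P.root_add_root_mem_of_pairingIn_neg h hij
      have hh := b.height_add hk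
      rw [RootPairing.Base.height_one_of_mem_support hi] at hh
      have := hθ k
      lia
  obtain ⟨f, hf0, hf⟩ := b.exists_root_eq_sum_nat_or_neg j
  rcases hf with hf | hf
  swap
  · apply hj
    rw [hf, sub_neg_eq_add]
    exact add_mem hθC (sum_mem fun i hi ↦ by
      have h0 : P.root i ∈ AddSubmonoid.closure (P.root '' b.support) :=
        AddSubmonoid.subset_closure ⟨i, hi, rfl⟩
      exact nsmul_mem h0 _)
  have hpair : ∀ k, P.pairingIn ℤ j k = ∑ i ∈ b.support, (f i : ℤ) * P.pairingIn ℤ i k := by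
    intro k
    apply FaithfulSMul.algebraMap_injective ℤ ℝ
    simp_rw [RootPairing.algebraMap_pairingIn, map_sum, map_mul,
      RootPairing.algebraMap_pairingIn, ← RootPairing.root_coroot_eq_pairing, hf, map_sum,
      map_nsmul, LinearMap.coe_sum, Finset.sum_apply, LinearMap.smul_apply]
    simp
  have hfull : ∀ i : b.support, f i ≠ 0 := by
    obtain ⟨i₁, hi₁⟩ : ∃ i : b.support, f i ≠ 0 := by
      by_contra! h
      apply P.ne_zero j
      rw [hf]
      exact Finset.sum_eq_zero fun i hi ↦ by rw [h ⟨i, hi⟩, zero_smul]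
    intro i
    refine b.induction_on_cartanMatrix (fun i ↦ f i ≠ 0) hi₁ ?_
    intro k l hk hkl hl
    have hne' : k ≠ l := by rintro rfl; exact hk hl
    have h1 := hdomj l l.2
    rw [hpair] at h1
    have h2 : ∑ i ∈ b.support, (f i : ℤ) * P.pairingIn ℤ i l < 0 := by
      refine Finset.sum_neg' (fun i hi ↦ ?_) ⟨k, k.2, ?_⟩
      · by_cases hil : i = l
        · rw [hil, hl]; simp
        · exact mul_nonpos_of_nonneg_of_nonpos (by positivity)
            (b.pairingIn_le_zero_of_ne hil hi l.2)
      · have h3 : P.pairingIn ℤ k l ≤ 0 :=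
          b.pairingIn_le_zero_of_ne (fun h ↦ hne' (Subtype.ext h)) k.2 l.2
        have h4 : P.pairingIn ℤ k l ≠ 0 := by
          intro h
          apply hkl
          rw [RootPairing.pairingIn_eq_zero_iff] at h
          exact h
        have h5 : (0 : ℤ) < f k := by exact_mod_cast Nat.pos_of_ne_zero hk
        exact mul_neg_of_pos_of_neg h5 (lt_of_le_of_ne h3 h4)
    lia
  have hθj : 0 < P.pairingIn ℤ j θ := by
    have hnn : ∀ i ∈ b.support, 0 ≤ P.pairingIn ℤ i θ := by
      intro i hi
      by_contra h
      push Not at h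
      rw [P.pairingIn_lt_zero_iff] at h
      exact absurd (hdomθ i hi) (not_le.mpr h)
    obtain ⟨i, hi, hi'⟩ := hθpos.exists_mem_support_pos_pairingIn
    rw [hpair]
    refine Finset.sum_pos' (fun i hi ↦ mul_nonneg (by positivity) (hnn i hi)) ⟨i, hi, ?_⟩
    have h5 : (0 : ℤ) < f i := by exact_mod_cast Nat.pos_of_ne_zero (hfull ⟨i, hi⟩)
    exact mul_pos h5 hi'
  have hjθ : θ ≠ j := by
    rintro rfl
    exact hj (by simp)
  rw [P.zero_lt_pairingIn_iff'] at hθj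
  obtain ⟨k, hk⟩ := P.root_sub_root_mem_of_pairingIn_pos hθj hjθ
  have hh := b.height_sub hk
  have h6 := hθ j
  apply hj
  rw [← hk]
  exact hpos k (by rw [RootPairing.Base.isPos_iff']; lia)

/-- (The index of) the highest root. -/
def highestRoot [Finite ι] [P.IsRootSystem] [P.IsCrystallographic] [P.IsReduced]
    [P.IsIrreducible] (b : P.Base) : ι :=
  (exists_isHighestRoot b).choose

/-- The coefficient `m_i` of the simple root `α_i` in the highest root. -/
def mark [Finite ι] [P.IsRootSystem] [P.IsCrystallographic] [P.IsReduced]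
    [P.IsIrreducible] (b : P.Base) (i : b.support) : ℝ :=
  b.toWeightBasis.repr (P.root (highestRoot b)) i

/-- The root polytope: the convex hull of all the roots. -/
def rootPolytope (P : RootPairing ι ℝ E N) : Set E :=
  convexHull ℝ (Set.range P.root)

/-- The subgroup of the Weyl group generated by the reflections in the simple roots other
than `α_i`. -/
def parabolicSubgroup (b : P.Base) (i : b.support) : Subgroup P.weylGroup :=
  Subgroup.closure
    (RootPairing.weylGroup.ofIdx P '' {j : ι | j ∈ b.support ∧ j ≠ (i : ι)})

end HighestRoot

section Euclidean

variable {ι E N : Type*} [NormedAddCommGroup E] [InnerProductSpace ℝ E]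
  [AddCommGroup N] [Module ℝ N] {P : RootPairing ι ℝ E N}

theorem innerₗ_nondegenerate :
    LinearMap.BilinForm.Nondegenerate (innerₗ E : LinearMap.BilinForm ℝ E) := by
  refine ⟨fun x hx ↦ ?_, fun x hx ↦ ?_⟩
  · exact inner_self_eq_zero.mp (hx x)
  · exact inner_self_eq_zero.mp (hx x)

open Classical in
/-- The fundamental coweights: the basis of `E` dual, for the scalar product, to the basis of
simple roots. -/
def fundamentalCoweight [P.IsRootSystem] (b : P.Base) (i : b.support) : E :=
  LinearMap.BilinForm.dualBasis (innerₗ E : LinearMap.BilinForm ℝ E) innerₗ_nondegenerate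
    b.toWeightBasis i

/-- A closed half-space of `E`. -/
def IsHalfSpace (H : Set E) : Prop :=
  ∃ a : E, a ≠ 0 ∧ ∃ c : ℝ, H = {x : E | ⟪x, a⟫_ℝ ≤ c}

/-- The half-space `(x, w ω_i) ≤ m_i`. -/
def coweightHalfSpace [Finite ι] [P.IsRootSystem] [P.IsCrystallographic] [P.IsReduced]
    [P.IsIrreducible] (b : P.Base) (i : b.support) (w : P.weylGroup) : Set E :=
  {x : E | ⟪x, w • fundamentalCoweight b i⟫_ℝ ≤ mark b i}

/-- The affine root system `{α + k δ | α a root, k an integer}` in `E ⊕ ℝ δ`, which is modelled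
by `E × ℝ` with `δ = (0, 1)`. -/
def affineRoots (P : RootPairing ι ℝ E N) : Set (E × ℝ) :=
  {x | ∃ (i : ι) (k : ℤ), x = (P.root i, (k : ℝ))}

/-- The positive semidefinite form on `E ⊕ ℝ δ` that extends the scalar product of `E` and has
kernel `ℝ δ`. -/
def affineForm (x y : E × ℝ) : ℝ := ⟪x.1, y.1⟫_ℝ

/-- The reflection of `E ⊕ ℝ δ` in the affine root `β`. -/
def affineReflection (β x : E × ℝ) : E × ℝ :=
  x - (2 * affineForm x β / affineForm β β) • β

/-- The affine simple roots: `α₀ = -θ + δ` and the simple roots. -/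
def affineSimpleRoots [Finite ι] [P.IsRootSystem] [P.IsCrystallographic] [P.IsReduced]
    [P.IsIrreducible] (b : P.Base) : Set (E × ℝ) :=
  insert (-P.root (highestRoot b), 1) (Set.range fun i : b.support ↦ (P.root i, (0 : ℝ)))

/-- The root subsystem of the affine root system generated by a set `Γ` of affine roots: the
smallest set of affine roots that contains `Γ` and is stable under its own reflections. -/
def affineSubsystem (P : RootPairing ι ℝ E N) (Γ : Set (E × ℝ)) : Set (E × ℝ) :=
  ⋂₀ {S | Γ ⊆ S ∧ S ⊆ affineRoots P ∧ ∀ β ∈ S, ∀ γ ∈ S, affineReflection β γ ∈ S}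

/-- A set of affine roots is irreducible if it is nonempty and is not the union of two nonempty
mutually orthogonal subsets. -/
def IsIrreducibleSubsystem (S : Set (E × ℝ)) : Prop :=
  S.Nonempty ∧ ∀ S₁ S₂ : Set (E × ℝ), S₁ ∪ S₂ = S →
    (∀ x ∈ S₁, ∀ y ∈ S₂, affineForm x y = 0) → S₁ = ∅ ∨ S₂ = ∅

/-- The indices `i` such that the affine simple roots other than `α_i` generate an irreducible
subsystem of the affine root system. -/
def facetIndices [Finite ι] [P.IsRootSystem] [P.IsCrystallographic] [P.IsReduced]
    [P.IsIrreducible] (b : P.Base) : Set b.support :=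
  {i | IsIrreducibleSubsystem
    (affineSubsystem P (affineSimpleRoots b \ {(P.root i, (0 : ℝ))}))}

end Euclidean

end RootPolytope

end

open RootPolytope

noncomputable section

namespace RootPolytope

-- The Weyl group acting by isometries; the fundamental chamber as a strict fundamental domain.

section Weyl

variable {ι E N : Type*} [NormedAddCommGroup E] [InnerProductSpace ℝ E]
  [AddCommGroup N] [Module ℝ N] {P : RootPairing ι ℝ E N}

open RootPairing

-- If a point `x` satisfying all the inequalities were outside the polytope, a vector `y` would
-- separate it from the roots. Moving `x` by some `w` and then `w • y` by some `v` into the dominant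
-- chamber gives `(x, y) ≤ (w x, v w y) ≤ (θ, v w y)`, the last step because the inequalities make
-- `θ - w x` a nonnegative combination of simple roots. But `(θ, v w y)` is the value of `y` at a
-- root, a contradiction (`rootPolytope_eq`).
--
-- Which inequalities matter depends on the span `U` of the roots on the face `(x, ω_i) = m_i`. It
-- contains `θ` and is stable under the simple reflections other than `s_i`, so each other simple
-- root lies in `U` or in its orthogonal. If removing `α_i` leaves an irreducible affine subsystem,
-- the second case never occurs and `U = E` (`eq_zero_of_inner_faceRoots`): the face is a facet.
-- Otherwise the simple roots in the piece away from `α₀` are orthogonal to the whole face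
-- (`inner_faceRoots_eq_zero`), which is thus too small to be a facet, and its inequality is
-- redundant (`inner_le_of_facets`).
--
-- The barycentre of the roots on a facet lies on no other supporting hyperplane
-- (`exists_mem_facet`), so pushing it slightly outwards violates only that inequality. Distinct
-- pairs `(i, w)` give distinct facets by the fundamental domain property
-- (`eq_of_smul_fundamentalCoweight`).

/-- The scalar product of `E` is invariant under the Weyl group. -/
def IsInvariant (P : RootPairing ι ℝ E N) : Prop :=
  ∀ (i : ι) (x y : E), ⟪P.reflection i x, P.reflection i y⟫_ℝ = ⟪x, y⟫_ℝ

theorem IsInvariant.inner_smul_smul (h : IsInvariant P) (w : P.weylGroup) (x y : E) :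
    ⟪w • x, w • y⟫_ℝ = ⟪x, y⟫_ℝ := by
  revert x y
  obtain ⟨g, hg⟩ := w
  induction hg using weylGroup.induction with
  | mem i => exact h i
  | one => intro x y; rfl
  | mul g₁ g₂ hg₁ hg₂ hg₁' hg₂' =>
    intro x y
    rw [← Submonoid.mk_mul_mk _ _ _ hg₁ hg₂, mul_smul, mul_smul, hg₁', hg₂']

theorem IsInvariant.inner_smul_left (h : IsInvariant P) (w : P.weylGroup) (x y : E) :
    ⟪w • x, y⟫_ℝ = ⟪x, w⁻¹ • y⟫_ℝ := by
  rw [← h.inner_smul_smul w⁻¹, inv_smul_smul]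

theorem IsInvariant.inner_smul_right (h : IsInvariant P) (w : P.weylGroup) (x y : E) :
    ⟪x, w • y⟫_ℝ = ⟪w⁻¹ • x, y⟫_ℝ := by
  rw [← h.inner_smul_smul w⁻¹, inv_smul_smul]

theorem inner_root_self_pos (P : RootPairing ι ℝ E N) (i : ι) : 0 < ⟪P.root i, P.root i⟫_ℝ :=
  real_inner_self_pos.mpr (P.ne_zero i)

/-- The reflection negates its root, so invariance applied to `x` and that root determines the
coroot: reflections of the pairing are orthogonal reflections. -/
theorem IsInvariant.two_mul_inner_root (h : IsInvariant P) (i : ι) (x : E) :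
    2 * ⟪x, P.root i⟫_ℝ = P.toLinearMap x (P.coroot i) * ⟪P.root i, P.root i⟫_ℝ := by
  have h1 := h i x (P.root i)
  rw [P.reflection_apply_self, P.reflection_apply, inner_neg_right, inner_sub_left,
    real_inner_smul_left] at h1
  change -(_ - P.toLinearMap x (P.coroot i) * _) = _ at h1
  linarith

theorem IsInvariant.reflection_eq (h : IsInvariant P) (i : ι) (x : E) :
    P.reflection i x =
      x - (2 * ⟪x, P.root i⟫_ℝ / ⟪P.root i, P.root i⟫_ℝ) • P.root i := by
  rw [h.two_mul_inner_root, mul_div_cancel_right₀ _ (inner_root_self_pos P i).ne',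
    P.reflection_apply]
  rfl

theorem ofIdx_smul_eq_reflection (i : ι) (x : E) :
    weylGroup.ofIdx P i • x = P.reflection i x := rfl

theorem ofIdx_mul_self (i : ι) : weylGroup.ofIdx P i * weylGroup.ofIdx P i = 1 := by
  apply Subtype.ext
  change Equiv.reflection P i * Equiv.reflection P i = 1
  rw [mul_eq_one_iff_inv_eq, Equiv.reflection_inv]

/-- The Weyl group acts faithfully on `E`. -/
theorem weylGroup_ext {g g' : P.weylGroup} (h : ∀ x : E, g • x = g' • x) : g = g' := by
  apply Subtype.ext
  apply Equiv.weightHom_injective P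
  ext x
  exact h x

/-- The roots span `E`, so an element is determined by the permutation it induces on them. -/
theorem weylGroup_finite [Finite ι] [P.IsRootSystem] : Finite P.weylGroup := by
  refine Finite.of_injective (fun g ↦ P.weylGroupToPerm g) fun g g' hgg ↦ weylGroup_ext fun x ↦ ?_
  have hx : x ∈ Submodule.span ℝ (Set.range P.root) := by
    rw [RootPairing.IsRootSystem.span_root_eq_top (P := P)]; trivial
  induction hx using Submodule.span_induction with
  | mem x hx =>
    obtain ⟨i, rfl⟩ := hx
    rw [weylGroup_apply_root, weylGroup_apply_root]
    exact congrArg (fun e : ι ≃ ι ↦ P.root (e i)) hgg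
  | zero => rw [smul_zero, smul_zero]
  | add x y _ _ hx hy => rw [smul_add, smul_add, hx, hy]
  | smul a x _ hx => rw [smul_comm, smul_comm g', hx]

theorem IsInvariant.conj_ofIdx (h : IsInvariant P) {g : P.weylGroup} {j k : ι}
    (hjk : g • P.root j = P.root k) :
    g * weylGroup.ofIdx P j = weylGroup.ofIdx P k * g := by
  refine weylGroup_ext fun x ↦ ?_
  rw [mul_smul, mul_smul, ofIdx_smul_eq_reflection, ofIdx_smul_eq_reflection, h.reflection_eq,
    h.reflection_eq, ← hjk, h.inner_smul_smul, h.inner_smul_smul, smul_sub, smul_comm g]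

theorem ofIdx_smul_root (i j : ι) :
    weylGroup.ofIdx P i • P.root j = P.root (P.reflectionPerm i j) := by
  rw [ofIdx_smul_eq_reflection, root_reflectionPerm]

/-- The product of the reflections in the roots of a list. -/
def wordProd (P : RootPairing ι ℝ E N) (l : List ι) : P.weylGroup :=
  (l.map (weylGroup.ofIdx P)).prod

@[simp] theorem wordProd_nil : wordProd P [] = 1 := rfl

theorem wordProd_cons (i : ι) (l : List ι) :
    wordProd P (i :: l) = weylGroup.ofIdx P i * wordProd P l := by
  simp [wordProd]

theorem wordProd_append (l l' : List ι) :
    wordProd P (l ++ l') = wordProd P l * wordProd P l' := by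
  simp [wordProd]

variable [Finite ι] [P.IsCrystallographic] [P.IsReduced]

/-- The simple reflections generate the Weyl group. -/
theorem IsInvariant.exists_wordProd (h : IsInvariant P) (b : P.Base) (w : P.weylGroup) :
    ∃ l : List ι, (∀ i ∈ l, i ∈ b.support) ∧ wordProd P l = w := by
  have hroot : ∀ i, ∃ l : List ι, (∀ i ∈ l, i ∈ b.support) ∧
      wordProd P l = weylGroup.ofIdx P i := by
    intro i
    refine b.induction_reflect i (p := fun i ↦ ∃ l : List ι, (∀ i ∈ l, i ∈ b.support) ∧
      wordProd P l = weylGroup.ofIdx P i) ?_ ?_ ?_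
    · rintro i ⟨l, hl, hli⟩
      refine ⟨l, hl, hli.trans ?_⟩
      -- A root and its negative have the same reflection: conjugate `s_i` by itself.
      have := h.conj_ofIdx (ofIdx_smul_root (P := P) i i)
      exact mul_right_cancel this
    · intro i hi
      exact ⟨[i], by simpa using hi, by simp [wordProd]⟩
    · rintro i j ⟨l, hl, hli⟩ hj
      refine ⟨j :: (l ++ [j]), ?_, ?_⟩
      · intro k hk
        simp only [List.mem_cons, List.mem_append, List.not_mem_nil, or_false] at hk
        rcases hk with rfl | hk | rfl
        exacts [hj, hl _ hk, hj]
      · rw [wordProd_cons, wordProd_append, hli, wordProd_cons, wordProd_nil, mul_one,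
          ← mul_assoc, h.conj_ofIdx (ofIdx_smul_root (P := P) j i), mul_assoc, ofIdx_mul_self,
          mul_one]
  obtain ⟨g, hg⟩ := w
  induction hg using weylGroup.induction with
  | mem i => exact hroot i
  | one => exact ⟨[], by simp, rfl⟩
  | mul g₁ g₂ hg₁ hg₂ h₁ h₂ =>
    obtain ⟨l₁, h₁, h₁'⟩ := h₁
    obtain ⟨l₂, h₂, h₂'⟩ := h₂
    refine ⟨l₁ ++ l₂, ?_, ?_⟩
    · intro i hi
      rcases List.mem_append.mp hi with hi | hi
      exacts [h₁ i hi, h₂ i hi]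
    · rw [wordProd_append, h₁', h₂']
      rfl

/-- The exchange property. -/
theorem IsInvariant.exchange (h : IsInvariant P) (b : P.Base) (l : List ι)
    (hl : ∀ i ∈ l, i ∈ b.support) {j k : ι} (hj : j ∈ b.support)
    (hk : wordProd P l • P.root j = P.root k) (hneg : ¬ b.IsPos k) :
    ∃ l' : List ι, (∀ i ∈ l', i ∈ b.support) ∧ l'.length < l.length ∧
      wordProd P l' = wordProd P l * weylGroup.ofIdx P j := by
  induction l generalizing k with
  | nil =>
    rw [wordProd_nil, one_smul] at hk
    rw [← P.root.injective hk] at hneg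
    exact absurd (Base.isPos_of_mem_support hj) hneg
  | cons i t ih =>
    obtain ⟨k', hk'⟩ : ∃ k', wordProd P t • P.root j = P.root k' := ⟨_, weylGroup_apply_root _ _ _⟩
    have hit : ∀ i ∈ t, i ∈ b.support := fun a ha ↦ hl a (List.mem_cons_of_mem _ ha)
    have hi : i ∈ b.support := hl i List.mem_cons_self
    by_cases hpos : b.IsPos k'
    -- The simple reflection `s_i` permutes the positive roots other than `α_i`, so only `α_i` can
    -- become negative; the letter `i` is then the one to delete.
    · have hki : k' = i := by
        by_contra hne
        apply hneg
        rw [wordProd_cons, mul_smul, hk', ofIdx_smul_root] at hk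
        rw [← P.root.injective hk]
        exact hpos.reflectionPerm hi hne
      subst hki
      refine ⟨t, hit, by simp, ?_⟩
      rw [wordProd_cons, mul_assoc, h.conj_ofIdx hk', ← mul_assoc, ofIdx_mul_self, one_mul]
    · obtain ⟨l', h1, h2, h3⟩ := ih hit hk' hpos
      refine ⟨i :: l', ?_, by simpa using h2, ?_⟩
      · intro a ha
        rcases List.mem_cons.mp ha with rfl | ha
        exacts [hi, h1 a ha]
      · rw [wordProd_cons, wordProd_cons, h3, mul_assoc]

variable [P.IsRootSystem]

omit [P.IsCrystallographic] [P.IsReduced] in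
open Classical in
theorem inner_root_fundamentalCoweight (b : P.Base) (i j : b.support) :
    ⟪P.root i, fundamentalCoweight b j⟫_ℝ = if i = j then 1 else 0 := by
  have := LinearMap.BilinForm.apply_dualBasis_left
    (B := (innerₗ E : LinearMap.BilinForm ℝ E)) innerₗ_nondegenerate b.toWeightBasis j i
  rw [real_inner_comm]
  simpa [fundamentalCoweight] using this

omit [P.IsCrystallographic] [P.IsReduced] in
theorem repr_eq_inner (b : P.Base) (x : E) (i : b.support) :
    b.toWeightBasis.repr x i = ⟪x, fundamentalCoweight b i⟫_ℝ := by
  classical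
  conv_rhs => rw [← b.toWeightBasis.sum_repr x]
  simp [sum_inner, real_inner_smul_left, inner_root_fundamentalCoweight]

omit [P.IsCrystallographic] [P.IsReduced] in
theorem sum_inner_smul_root (b : P.Base) (x : E) :
    ∑ i : b.support, ⟪x, fundamentalCoweight b i⟫_ℝ • P.root i = x := by
  conv_rhs => rw [← b.toWeightBasis.sum_repr x]
  simp [repr_eq_inner]

/-- `y` lies in the closed fundamental chamber. -/
def IsDominant (b : P.Base) (y : E) : Prop := ∀ i : b.support, 0 ≤ ⟪P.root i, y⟫_ℝ

/-- `x` is a combination of simple roots with nonnegative coefficients. -/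
def IsNonneg (b : P.Base) (x : E) : Prop := ∀ i : b.support, 0 ≤ ⟪x, fundamentalCoweight b i⟫_ℝ

omit [P.IsCrystallographic] [P.IsReduced] in
theorem IsNonneg.inner_nonneg {b : P.Base} {x y : E} (hx : IsNonneg b x) (hy : IsDominant b y) :
    0 ≤ ⟪x, y⟫_ℝ := by
  rw [← sum_inner_smul_root b x, sum_inner]
  refine Finset.sum_nonneg fun i _ ↦ ?_
  rw [real_inner_smul_left]
  exact mul_nonneg (hx i) (hy i)

omit [P.IsCrystallographic] [P.IsReduced] in
theorem isDominant_fundamentalCoweight (b : P.Base) (i : b.support) :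
    IsDominant b (fundamentalCoweight b i) := by
  classical
  intro j
  rw [inner_root_fundamentalCoweight]
  split_ifs <;> norm_num

omit [P.IsCrystallographic] [P.IsReduced] in
theorem isNonneg_of_mem_closure {b : P.Base} {x : E}
    (hx : x ∈ AddSubmonoid.closure (P.root '' b.support)) : IsNonneg b x := by
  intro i
  induction hx using AddSubmonoid.closure_induction with
  | mem x hx =>
    obtain ⟨j, hj, rfl⟩ := hx
    exact isDominant_fundamentalCoweight b i ⟨j, hj⟩
  | zero => rw [inner_zero_left]
  | add x y _ _ hx hy => rw [inner_add_left]; exact add_nonneg hx hy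

omit [P.IsReduced] in
theorem isNonneg_root_of_isPos {b : P.Base} {i : ι} (hi : b.IsPos i) :
    IsNonneg b (P.root i) := by
  refine hi.induction_on_add (p := fun i ↦ IsNonneg b (P.root i)) (fun i hi ↦ ?_) ?_
  · exact isNonneg_of_mem_closure (AddSubmonoid.subset_closure ⟨i, hi, rfl⟩)
  · intro i j k hk hi hj l
    rw [hk, inner_add_left]
    exact add_nonneg (hi l) (isDominant_fundamentalCoweight b l ⟨j, hj⟩)

omit [P.IsCrystallographic] [P.IsReduced] in
/-- Every orbit of the Weyl group meets the fundamental chamber, at a point that is higher than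
the given one. -/
theorem IsInvariant.exists_isDominant_smul (h : IsInvariant P) (b : P.Base) (y : E) :
    ∃ w : P.weylGroup, IsDominant b (w • y) ∧ IsNonneg b (w • y - y) := by
  classical
  have := weylGroup_finite (P := P)
  have : Nonempty {w : P.weylGroup // IsNonneg b (w • y - y)} :=
    ⟨1, fun i ↦ by rw [one_smul, sub_self, inner_zero_left]⟩
  -- Among the conjugates above `y`, take one of greatest height. Reflecting in a violated wall
  -- would add a positive multiple of a simple root and raise the height.
  obtain ⟨⟨w, hw⟩, hmax⟩ := Finite.exists_max
    (fun w : {w : P.weylGroup // IsNonneg b (w • y - y)} ↦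
      ⟪w.1 • y, ∑ i, fundamentalCoweight b i⟫_ℝ)
  refine ⟨w, fun i ↦ ?_, hw⟩
  by_contra! hneg
  set c := -(2 * ⟪w • y, P.root i⟫_ℝ / ⟪P.root i, P.root i⟫_ℝ) with hc
  have hc0 : 0 < c := by
    rw [hc, ← neg_div]
    refine div_pos ?_ (inner_root_self_pos P i)
    rw [real_inner_comm]; linarith
  have hs : (weylGroup.ofIdx P i * w) • y = w • y + c • P.root i := by
    rw [mul_smul, ofIdx_smul_eq_reflection, h.reflection_eq, hc, neg_smul, sub_eq_add_neg]
  have h1 : IsNonneg b ((weylGroup.ofIdx P i * w) • y - y) := by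
    intro j
    rw [hs, add_sub_right_comm, inner_add_left, real_inner_smul_left]
    exact add_nonneg (hw j) (mul_nonneg hc0.le (isDominant_fundamentalCoweight b j i))
  have h2 := hmax ⟨_, h1⟩
  simp only [hs, inner_add_left, real_inner_smul_left, inner_sum,
    inner_root_fundamentalCoweight, Finset.sum_add_distrib] at h2
  simp at h2
  linarith

/-- The fundamental chamber is a strict fundamental domain of the Weyl group, and the stabilizer
of a point of it is generated by simple reflections. -/
theorem IsInvariant.smul_eq_of_isDominant (h : IsInvariant P) {b : P.Base} {y : E}
    {w : P.weylGroup} (hy : IsDominant b y) (hwy : IsDominant b (w • y)) :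
    w • y = y ∧ w ∈ Subgroup.closure
      (weylGroup.ofIdx P '' {j : ι | j ∈ b.support ∧ ⟪P.root j, y⟫_ℝ = 0}) := by
  obtain ⟨l, hl, rfl⟩ := h.exists_wordProd b w
  induction hn : l.length using Nat.strong_induction_on generalizing l with
  | _ n ih =>
    subst hn
    rcases List.eq_nil_or_concat' l with rfl | ⟨t, j, rfl⟩
    · exact ⟨one_smul _ _, one_mem _⟩
    have ht : ∀ i ∈ t, i ∈ b.support := fun i hi ↦ hl i (List.mem_append_left _ hi)
    have hj : j ∈ b.support := hl j (by simp)
    have hprod : wordProd P (t ++ [j]) = wordProd P t * weylGroup.ofIdx P j := by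
      rw [wordProd_append, wordProd_cons, wordProd_nil, mul_one]
    obtain ⟨k, hk⟩ : ∃ k, wordProd P t • P.root j = P.root k := ⟨_, weylGroup_apply_root _ _ _⟩
    -- If the prefix `t` keeps `α_j` positive, the full word makes it negative, and dominance of
    -- both points forces `(α_j, y) = 0`, so `s_j` fixes `y` and can be dropped. Otherwise exchange
    -- shortens the word.
    by_cases hpos : b.IsPos k
    · have hwj : wordProd P (t ++ [j]) • P.root j = -P.root k := by
        rw [hprod, mul_smul, ofIdx_smul_eq_reflection, P.reflection_apply_self, smul_neg, hk]
      have h0 : ⟪P.root j, y⟫_ℝ = 0 := by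
        apply le_antisymm _ (hy ⟨j, hj⟩)
        rw [← h.inner_smul_smul (wordProd P (t ++ [j])), hwj, inner_neg_left, neg_nonpos]
        exact (isNonneg_root_of_isPos hpos).inner_nonneg hwy
      have hfix : weylGroup.ofIdx P j • y = y := by
        rw [ofIdx_smul_eq_reflection, h.reflection_eq, real_inner_comm, h0]
        simp
      have hty : wordProd P (t ++ [j]) • y = wordProd P t • y := by
        rw [hprod, mul_smul, hfix]
      rw [hty] at hwy ⊢
      obtain ⟨h1, h2⟩ := ih t.length (by simp) t ht hwy rfl
      refine ⟨h1, ?_⟩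
      rw [hprod]
      exact mul_mem h2 (Subgroup.subset_closure ⟨j, ⟨hj, h0⟩, rfl⟩)
    · obtain ⟨l', h1, h2, h3⟩ := h.exchange b t ht hj hk hpos
      rw [hprod, ← h3] at hwy ⊢
      exact ih l'.length (by simp; lia) l' h1 hwy rfl

end Weyl

-- The inequality description, and the span of the roots on each face.

section Faces

variable {ι E N : Type*} [NormedAddCommGroup E] [InnerProductSpace ℝ E]
  [AddCommGroup N] [Module ℝ N] {P : RootPairing ι ℝ E N}
  [Finite ι] [P.IsCrystallographic] [P.IsReduced] [P.IsRootSystem] [P.IsIrreducible]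

open RootPairing

theorem isHighestRoot_highestRoot (b : P.Base) : IsHighestRoot b (highestRoot b) :=
  (exists_isHighestRoot b).choose_spec

theorem isNonneg_highestRoot_sub (b : P.Base) (j : ι) :
    IsNonneg b (P.root (highestRoot b) - P.root j) :=
  isNonneg_of_mem_closure (isHighestRoot_highestRoot b j)

theorem mark_eq_inner (b : P.Base) (i : b.support) :
    mark b i = ⟪P.root (highestRoot b), fundamentalCoweight b i⟫_ℝ :=
  repr_eq_inner b _ i

theorem inner_root_le_mark (b : P.Base) (j : ι) (i : b.support) :
    ⟪P.root j, fundamentalCoweight b i⟫_ℝ ≤ mark b i := by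
  have := isNonneg_highestRoot_sub b j i
  rw [inner_sub_left, ← mark_eq_inner] at this
  linarith

theorem mark_pos (b : P.Base) (i : b.support) : 0 < mark b i := by
  have := inner_root_le_mark b i i
  rw [inner_root_fundamentalCoweight, if_pos rfl] at this
  linarith

theorem IsInvariant.rootPolytope_subset (h : IsInvariant P) (b : P.Base) :
    rootPolytope P ⊆ {x : E | ∀ (w : P.weylGroup) (i : b.support),
      ⟪x, w • fundamentalCoweight b i⟫_ℝ ≤ mark b i} := by
  refine convexHull_min ?_ ?_
  · rintro _ ⟨j, rfl⟩ w i
    rw [h.inner_smul_right, weylGroup_apply_root]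
    exact inner_root_le_mark b _ i
  · simp only [Set.ofPred_forall]
    refine convex_iInter fun w ↦ convex_iInter fun i ↦ ?_
    exact convex_halfSpace_le (f := fun x ↦ ⟪x, w • fundamentalCoweight b i⟫_ℝ)
      ⟨fun x y ↦ inner_add_left _ _ _, fun c x ↦ real_inner_smul_left _ _ _⟩ _

theorem IsInvariant.rootPolytope_eq (h : IsInvariant P) (b : P.Base) :
    rootPolytope P = {x : E | ∀ (w : P.weylGroup) (i : b.support),
      ⟪x, w • fundamentalCoweight b i⟫_ℝ ≤ mark b i} := by
  refine (h.rootPolytope_subset b).antisymm fun x hx ↦ ?_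
  have : FiniteDimensional ℝ E := b.toWeightBasis.finiteDimensional_of_finite
  have : CompleteSpace E := FiniteDimensional.complete ℝ E
  by_contra hxP
  obtain ⟨f, u, hf, hu⟩ := geometric_hahn_banach_closed_point (convex_convexHull ℝ _)
    ((Set.finite_range P.root).isCompact_convexHull (𝕜 := ℝ)).isClosed hxP
  set y : E := (InnerProductSpace.toDual ℝ E).symm f with hy
  have hfy : ∀ z, f z = ⟪z, y⟫_ℝ := fun z ↦ by
    rw [hy, real_inner_comm, InnerProductSpace.toDual_symm_apply]
  -- Dominance of `w • x` serves `h1`; dominance of `v • w • y` serves `h2`.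
  obtain ⟨w, hw, -⟩ := h.exists_isDominant_smul b x
  obtain ⟨v, hv, hv'⟩ := h.exists_isDominant_smul b (w • y)
  have h1 : ⟪x, y⟫_ℝ ≤ ⟪w • x, v • w • y⟫_ℝ := by
    have := hv'.inner_nonneg hw
    rw [inner_sub_left, real_inner_comm, real_inner_comm (w • x), h.inner_smul_smul] at this
    linarith
  have h2 : ⟪w • x, v • w • y⟫_ℝ ≤ ⟪P.root (highestRoot b), v • w • y⟫_ℝ := by
    have : IsNonneg b (P.root (highestRoot b) - w • x) := fun i ↦ by
      have := hx w⁻¹ i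
      rw [inner_sub_left, ← mark_eq_inner, h.inner_smul_left]
      linarith
    have := this.inner_nonneg hv
    rw [inner_sub_left] at this
    linarith
  have h3 : ⟪P.root (highestRoot b), v • w • y⟫_ℝ < u := by
    rw [h.inner_smul_right, h.inner_smul_right, weylGroup_apply_root, weylGroup_apply_root, ← hfy]
    exact hf _ (subset_convexHull ℝ _ ⟨_, rfl⟩)
  rw [hfy] at hu
  linarith

/-- The indices of the roots on the face of the root polytope defined by `(x, ω_i) = m_i`. -/
def faceRoots (b : P.Base) (i : b.support) : Set ι :=
  {j | ⟪P.root j, fundamentalCoweight b i⟫_ℝ = mark b i}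

theorem highestRoot_mem_faceRoots (b : P.Base) (i : b.support) :
    highestRoot b ∈ faceRoots b i :=
  (mark_eq_inner b i).symm

theorem IsInvariant.reflectionPerm_mem_faceRoots (h : IsInvariant P) {b : P.Base}
    {i j : b.support} (hij : j ≠ i) {k : ι} (hk : k ∈ faceRoots b i) :
    P.reflectionPerm j k ∈ faceRoots b i := by
  change ⟪_, _⟫_ℝ = _
  rw [root_reflectionPerm, h.reflection_eq, inner_sub_left, real_inner_smul_left,
    inner_root_fundamentalCoweight, if_neg hij, mul_zero, sub_zero]
  exact hk

omit [Finite ι] [P.IsCrystallographic] [P.IsReduced] [P.IsRootSystem] [P.IsIrreducible] in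
theorem affineForm_self_pos {x : E × ℝ} (hx : x ∈ affineRoots P) : 0 < affineForm x x := by
  obtain ⟨i, k, rfl⟩ := hx
  exact inner_root_self_pos P i

-- The reflection coefficient is a Cartan integer, so the coefficient of `δ` stays integral. This
-- makes all affine roots a competitor in the intersection defining `affineSubsystem`.
omit [Finite ι] [P.IsReduced] [P.IsRootSystem] [P.IsIrreducible] in
theorem IsInvariant.affineReflection_mem (h : IsInvariant P) {β γ : E × ℝ}
    (hβ : β ∈ affineRoots P) (hγ : γ ∈ affineRoots P) :
    affineReflection β γ ∈ affineRoots P := by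
  obtain ⟨i, k, rfl⟩ := hβ
  obtain ⟨j, l, rfl⟩ := hγ
  have hc : 2 * ⟪P.root j, P.root i⟫_ℝ / ⟪P.root i, P.root i⟫_ℝ = (P.pairingIn ℤ j i : ℝ) := by
    rw [h.two_mul_inner_root, mul_div_cancel_right₀ _ (inner_root_self_pos P i).ne',
      root_coroot_eq_pairing]
    exact (P.algebraMap_pairingIn ℤ j i).symm
  refine ⟨P.reflectionPerm i j, l - P.pairingIn ℤ j i * k, ?_⟩
  rw [root_reflectionPerm, h.reflection_eq, affineReflection]
  simp only [affineForm, hc]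
  ext <;> simp

theorem affineSimpleRoots_subset (b : P.Base) : affineSimpleRoots b ⊆ affineRoots P := by
  rintro _ (rfl | ⟨i, rfl⟩)
  · exact ⟨P.reflectionPerm (highestRoot b) (highestRoot b), 1, by simp⟩
  · exact ⟨i, 0, by simp⟩

omit [Finite ι] [P.IsCrystallographic] [P.IsReduced] [P.IsRootSystem] [P.IsIrreducible] in
theorem subset_affineSubsystem (P : RootPairing ι ℝ E N)
    (Γ : Set (E × ℝ)) : Γ ⊆ affineSubsystem P Γ :=
  Set.subset_sInter fun _ hS ↦ hS.1

omit [Finite ι] [P.IsReduced] [P.IsRootSystem] [P.IsIrreducible] in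
theorem IsInvariant.affineSubsystem_subset (h : IsInvariant P) {Γ : Set (E × ℝ)}
    (hΓ : Γ ⊆ affineRoots P) : affineSubsystem P Γ ⊆ affineRoots P :=
  Set.sInter_subset_of_mem ⟨hΓ, subset_rfl, fun _ hβ _ hγ ↦ h.affineReflection_mem hβ hγ⟩

omit [Finite ι] [P.IsCrystallographic] [P.IsReduced] [P.IsRootSystem] [P.IsIrreducible] in
theorem affineReflection_mem_affineSubsystem {Γ : Set (E × ℝ)} {β γ : E × ℝ}
    (hβ : β ∈ affineSubsystem P Γ) (hγ : γ ∈ affineSubsystem P Γ) :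
    affineReflection β γ ∈ affineSubsystem P Γ :=
  fun S hS ↦ hS.2.2 β (hβ S hS) γ (hγ S hS)

theorem neg_highestRoot_mem_diff (b : P.Base) (i : b.support) :
    (-P.root (highestRoot b), (1 : ℝ)) ∈ affineSimpleRoots b \ {(P.root i, (0 : ℝ))} :=
  ⟨Set.mem_insert _ _, fun h ↦ one_ne_zero (congrArg Prod.snd h)⟩

theorem simpleRoot_mem_diff (b : P.Base) {i j : b.support} (hij : j ≠ i) :
    (P.root j, (0 : ℝ)) ∈ affineSimpleRoots b \ {(P.root i, (0 : ℝ))} :=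
  ⟨Set.mem_insert_of_mem _ ⟨j, rfl⟩,
    fun h ↦ hij (Subtype.ext (P.root.injective (congrArg Prod.fst h)))⟩

/-- The roots on a face with index in `facetIndices` span the whole space. -/
theorem IsInvariant.eq_zero_of_inner_faceRoots (h : IsInvariant P) {b : P.Base} {i : b.support}
    (hi : i ∈ facetIndices b) {z : E} (hz : ∀ j ∈ faceRoots b i, ⟪P.root j, z⟫_ℝ = 0) :
    z = 0 := by
  set U : Submodule ℝ E := Submodule.span ℝ (P.root '' faceRoots b i) with hU
  have hθU : P.root (highestRoot b) ∈ U :=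
    Submodule.subset_span ⟨_, highestRoot_mem_faceRoots b i, rfl⟩
  have hstab : ∀ j : b.support, j ≠ i → ∀ x ∈ U, P.reflection j x ∈ U := by
    intro j hj x hx
    induction hx using Submodule.span_induction with
    | mem x hx =>
      obtain ⟨k, hk, rfl⟩ := hx
      rw [← root_reflectionPerm]
      exact Submodule.subset_span ⟨_, h.reflectionPerm_mem_faceRoots hj hk, rfl⟩
    | zero => rw [map_zero]; exact U.zero_mem
    | add x y _ _ hx hy => rw [map_add]; exact U.add_mem hx hy
    | smul a x _ hx => rw [map_smul]; exact U.smul_mem a hx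
  -- For `x ∈ U`, the difference `x - s_j x` lies in `U` and is a multiple of `α_j`, nonzero unless
  -- `x` is orthogonal to `α_j`.
  have hdich : ∀ j : b.support, j ≠ i → P.root j ∈ U ∨ P.root j ∈ Uᗮ := by
    intro j hj
    by_contra! hcon
    obtain ⟨h1, h2⟩ := hcon
    apply h2
    rw [Submodule.mem_orthogonal]
    intro x hx
    by_contra hne
    apply h1
    have h3 := U.sub_mem hx (hstab j hj x hx)
    rw [h.reflection_eq, sub_sub_cancel] at h3
    refine (U.smul_mem_iff ?_).mp h3
    exact div_ne_zero (mul_ne_zero two_ne_zero hne) (inner_root_self_pos P j).ne'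
  set Γ := affineSimpleRoots b \ {(P.root i, (0 : ℝ))} with hΓ
  -- The splitting into `U` and `Uᗮ` passes from generators to the subsystem, since reflections in
  -- one part fix the other.
  have hsub : affineSubsystem P Γ ⊆ {γ | γ ∈ affineRoots P ∧ (γ.1 ∈ U ∨ γ.1 ∈ Uᗮ)} := by
    refine Set.sInter_subset_of_mem ⟨?_, fun γ hγ ↦ hγ.1, ?_⟩
    · rintro γ ⟨hγ, hγi⟩
      refine ⟨affineSimpleRoots_subset b hγ, ?_⟩
      rcases hγ with rfl | ⟨j, rfl⟩
      · exact Or.inl (U.neg_mem hθU)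
      · exact hdich j fun hji ↦ hγi (by rw [hji]; rfl)
    · rintro β ⟨hβ, hβU⟩ γ ⟨hγ, hγU⟩
      refine ⟨h.affineReflection_mem hβ hγ, ?_⟩
      have hortho : affineForm γ β = 0 → affineReflection β γ = γ := fun h0 ↦ by
        simp [affineReflection, h0]
      rcases hβU with hβU | hβU <;> rcases hγU with hγU | hγU
      · exact Or.inl (U.sub_mem hγU (U.smul_mem _ hβU))
      · rw [hortho (Submodule.inner_left_of_mem_orthogonal hβU hγU)]
        exact Or.inr hγU
      · rw [hortho (Submodule.inner_right_of_mem_orthogonal hγU hβU)]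
        exact Or.inl hγU
      · exact Or.inr (Uᗮ.sub_mem hγU (Uᗮ.smul_mem _ hβU))
  have hempty := hi.2 {γ | γ ∈ affineSubsystem P Γ ∧ γ.1 ∈ U}
    {γ | γ ∈ affineSubsystem P Γ ∧ γ.1 ∈ Uᗮ}
    (by
      ext γ
      constructor
      · rintro (hγ | hγ) <;> exact hγ.1
      · intro hγ
        exact (hsub hγ).2.imp (fun h' ↦ ⟨hγ, h'⟩) (fun h' ↦ ⟨hγ, h'⟩))
    (fun x hx y hy ↦ Submodule.inner_right_of_mem_orthogonal hx.2 hy.2)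
  have hall : ∀ j : b.support, j ≠ i → P.root j ∈ U := by
    intro j hj
    refine (hdich j hj).resolve_right fun hjU ↦ ?_
    rcases hempty with he | he
    · exact Set.eq_empty_iff_forall_notMem.mp he _
        ⟨subset_affineSubsystem P Γ (neg_highestRoot_mem_diff b i), U.neg_mem hθU⟩
    · exact Set.eq_empty_iff_forall_notMem.mp he _
        ⟨subset_affineSubsystem P Γ (simpleRoot_mem_diff b hj), hjU⟩
  have hzU : ∀ x ∈ U, ⟪x, z⟫_ℝ = 0 := by
    intro x hx
    induction hx using Submodule.span_induction with
    | mem x hx => obtain ⟨k, hk, rfl⟩ := hx; exact hz k hk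
    | zero => exact inner_zero_left _
    | add x y _ _ hx hy => rw [inner_add_left, hx, hy, add_zero]
    | smul a x _ hx => rw [real_inner_smul_left, hx, mul_zero]
  have hsimple : ∀ j : b.support, ⟪P.root j, z⟫_ℝ = 0 := by
    intro j
    -- For `α_i` itself, expand `θ ∈ U`: the other terms vanish, leaving `m_i (α_i, z) = 0` with
    -- `m_i > 0`.
    by_cases hj : j = i
    · have h1 := hzU _ hθU
      rw [← sum_inner_smul_root b (P.root (highestRoot b)), sum_inner,
        Finset.sum_eq_single_of_mem i (Finset.mem_univ _) (fun k _ hk ↦ by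
          rw [real_inner_smul_left, hzU _ (hall k hk), mul_zero]),
        real_inner_smul_left, ← mark_eq_inner] at h1
      rw [hj]
      exact (mul_eq_zero.mp h1).resolve_left (mark_pos b i).ne'
    · exact hzU _ (hall j hj)
  refine inner_self_eq_zero (𝕜 := ℝ).mp ?_
  nth_rewrite 1 [← sum_inner_smul_root b z]
  rw [sum_inner]
  exact Finset.sum_eq_zero fun j _ ↦ by rw [real_inner_smul_left, hsimple, mul_zero]

/-- A counterexample of greatest height has a negative product with some simple root in `I`, for
otherwise the `I`-part `γ` of its difference from `θ` would satisfy `(γ, γ) ≤ 0`. Reflecting in that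
simple root gives a higher counterexample. -/
theorem IsInvariant.inner_faceRoots_eq_zero (h : IsInvariant P) {b : P.Base} {i : b.support}
    {I : Set b.support} (hi : i ∉ I) (hθ : ∀ j ∈ I, ⟪P.root (highestRoot b), P.root j⟫_ℝ = 0)
    (hI : ∀ j ∈ I, ∀ k ∉ I, k ≠ i → ⟪P.root k, P.root j⟫_ℝ = 0) :
    ∀ k ∈ faceRoots b i, ∀ j ∈ I, ⟪P.root k, P.root j⟫_ℝ = 0 := by
  classical
  by_contra! hcon
  obtain ⟨k₀, hk₀, hk₀'⟩ := hcon
  have : Nonempty {k // k ∈ faceRoots b i ∧ ∃ j ∈ I, ⟪P.root k, P.root j⟫_ℝ ≠ 0} :=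
    ⟨⟨k₀, hk₀, hk₀'⟩⟩
  obtain ⟨⟨k, hk, hk'⟩, hmax⟩ := Finite.exists_max
    (fun k : {k // k ∈ faceRoots b i ∧ ∃ j ∈ I, ⟪P.root k, P.root j⟫_ℝ ≠ 0} ↦
      ⟪P.root k, ∑ l, fundamentalCoweight b l⟫_ℝ)
  set c : b.support → ℝ := fun l ↦
    ⟪P.root (highestRoot b) - P.root k, fundamentalCoweight b l⟫_ℝ with hc
  have hc0 : ∀ l, 0 ≤ c l := isNonneg_highestRoot_sub b k
  set γ : E := ∑ l with l ∈ I, c l • P.root l with hγ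
  -- Only the terms in `I` contribute: the coefficient at `i` vanishes because both roots are on the
  -- face, and the remaining simple roots are orthogonal to `I`.
  have hinner : ∀ j ∈ I, ⟪P.root k, P.root j⟫_ℝ = -⟪γ, P.root j⟫_ℝ := by
    intro j hj
    have h1 : ⟪P.root (highestRoot b) - P.root k, P.root j⟫_ℝ = ⟪γ, P.root j⟫_ℝ := by
      rw [← sum_inner_smul_root b (P.root (highestRoot b) - P.root k), hγ, sum_inner, sum_inner,
        Finset.sum_filter]
      refine Finset.sum_congr rfl fun l _ ↦ ?_
      split_ifs with hl
      · rfl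
      · rw [real_inner_smul_left]
        by_cases hli : l = i
        · rw [hli, inner_sub_left, ← mark_eq_inner, show ⟪P.root k, _⟫_ℝ = _ from hk, sub_self,
            zero_mul]
        · rw [hI j hj l hl hli, mul_zero]
    rw [inner_sub_left, hθ j hj] at h1
    linarith
  obtain ⟨j, hj, hneg⟩ : ∃ j ∈ I, ⟪P.root k, P.root j⟫_ℝ < 0 := by
    by_contra! hnn
    have hγ0 : γ = 0 := by
      refine inner_self_eq_zero (𝕜 := ℝ).mp (le_antisymm ?_ real_inner_self_nonneg)
      nth_rewrite 2 [hγ]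
      rw [inner_sum]
      refine Finset.sum_nonpos fun l hl ↦ ?_
      have hl : l ∈ I := by simpa using hl
      rw [real_inner_smul_right]
      have h2 := hnn l hl
      rw [hinner l hl] at h2
      exact mul_nonpos_of_nonneg_of_nonpos (hc0 l) (by linarith)
    obtain ⟨j, hj, hj'⟩ := hk'
    rw [hinner j hj, hγ0, inner_zero_left, neg_zero] at hj'
    exact hj' rfl
  have hji : j ≠ i := fun hji ↦ hi (hji ▸ hj)
  have hroot : P.root (P.reflectionPerm j k) = P.root k +
      (-(2 * ⟪P.root k, P.root j⟫_ℝ / ⟪P.root j, P.root j⟫_ℝ)) • P.root j := by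
    rw [root_reflectionPerm, h.reflection_eq, neg_smul, sub_eq_add_neg]
  have hne : ⟪P.root (P.reflectionPerm j k), P.root j⟫_ℝ ≠ 0 := by
    rw [hroot, inner_add_left, real_inner_smul_left, neg_mul,
      div_mul_cancel₀ _ (inner_root_self_pos P j).ne']
    intro h0
    linarith
  have h3 := hmax ⟨P.reflectionPerm j k, h.reflectionPerm_mem_faceRoots hji hk, j, hj, hne⟩
  have h4 : 0 < -(2 * ⟪P.root k, P.root j⟫_ℝ / ⟪P.root j, P.root j⟫_ℝ) := by
    rw [← neg_div]
    exact div_pos (by linarith) (inner_root_self_pos P j)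
  rw [hroot, inner_add_left, real_inner_smul_left] at h3
  have h5 : ⟪P.root j, ∑ l, fundamentalCoweight b l⟫_ℝ = 1 := by
    simp [inner_sum, inner_root_fundamentalCoweight]
  rw [h5] at h3
  linarith

/-- The roots on a face with index outside `facetIndices` are orthogonal to a simple root. -/
theorem IsInvariant.exists_inner_faceRoots_eq_zero (h : IsInvariant P) {b : P.Base}
    {i : b.support} (hi : i ∉ facetIndices b) :
    ∃ j : b.support, ∀ k ∈ faceRoots b i, ⟪P.root k, P.root j⟫_ℝ = 0 := by
  set Γ := affineSimpleRoots b \ {(P.root i, (0 : ℝ))} with hΓ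
  have hθ := neg_highestRoot_mem_diff b i
  have hsymm : ∀ x y : E × ℝ, affineForm x y = affineForm y x := fun x y ↦ real_inner_comm _ _
  -- The pieces are named so that `α₀` lies in `S₁`.
  obtain ⟨S₁, S₂, hS, horth, hne, hθS⟩ : ∃ S₁ S₂ : Set (E × ℝ), S₁ ∪ S₂ = affineSubsystem P Γ ∧
      (∀ x ∈ S₁, ∀ y ∈ S₂, affineForm x y = 0) ∧ S₂.Nonempty ∧
      (-P.root (highestRoot b), (1 : ℝ)) ∈ S₁ := by
    have h1 : ¬ IsIrreducibleSubsystem (affineSubsystem P Γ) := hi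
    rw [IsIrreducibleSubsystem, not_and] at h1
    have h2 := h1 ⟨_, subset_affineSubsystem P Γ hθ⟩
    push Not at h2
    obtain ⟨S₁, S₂, hS, horth, h1, h2⟩ := h2
    have h3 := subset_affineSubsystem P Γ hθ
    rw [← hS] at h3
    rcases h3 with h3 | h3
    · exact ⟨S₁, S₂, hS, horth, h2, h3⟩
    · exact ⟨S₂, S₁, by rw [Set.union_comm, hS], fun x hx y hy ↦ by rw [hsymm, horth y hy x hx],
        h1, h3⟩
  have hroots := h.affineSubsystem_subset (Set.sdiff_subset.trans (affineSimpleRoots_subset b) :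
    Γ ⊆ affineRoots P)
  have hS₁ : S₁ ⊆ affineSubsystem P Γ := hS ▸ Set.subset_union_left
  have hS₂ : S₂ ⊆ affineSubsystem P Γ := hS ▸ Set.subset_union_right
  have hdisj : ∀ x ∈ S₁, x ∉ S₂ := fun x hx hx' ↦
    (affineForm_self_pos (hroots (hS₁ hx))).ne' (horth x hx x hx')
  -- Otherwise `S₁` would be the whole subsystem: it is closed under its reflections, since a
  -- reflected root lying in `S₂` would be orthogonal to itself.
  have hnot : ¬ Γ ⊆ S₁ := by
    intro hsub
    obtain ⟨x, hx⟩ := hne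
    refine hdisj x ?_ hx
    have : affineSubsystem P Γ ⊆ S₁ := by
      refine Set.sInter_subset_of_mem ⟨hsub, hS₁.trans hroots, fun β hβ γ hγ ↦ ?_⟩
      have hr := affineReflection_mem_affineSubsystem (hS₁ hβ) (hS₁ hγ)
      have hr' := hr
      rw [← hS] at hr'
      refine hr'.resolve_right fun hr₂ ↦ (affineForm_self_pos (hroots hr)).ne' ?_
      have h1 : ⟪β.1, (affineReflection β γ).1⟫_ℝ = 0 := horth β hβ _ hr₂
      have h2 : ⟪γ.1, (affineReflection β γ).1⟫_ℝ = 0 := horth γ hγ _ hr₂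
      change ⟪γ.1 - _ • β.1, (affineReflection β γ).1⟫_ℝ = 0
      rw [inner_sub_left, real_inner_smul_left, h1, h2, mul_zero, sub_zero]
    exact this (hS₂ hx)
  obtain ⟨γ, hγ, hγS⟩ := Set.not_subset.mp hnot
  obtain ⟨j, rfl⟩ : ∃ j : b.support, (P.root j, (0 : ℝ)) = γ := by
    rcases hγ.1 with rfl | hj
    · exact absurd hθS hγS
    · exact hj
  have hγi : j ≠ i := fun hji ↦ hγ.2 (by rw [hji]; rfl)
  have hmem : ∀ k : b.support, k ≠ i → (P.root k, (0 : ℝ)) ∈ S₁ ∪ S₂ := fun k hk ↦ by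
    rw [hS]
    exact subset_affineSubsystem P Γ (simpleRoot_mem_diff b hk)
  refine ⟨j, fun k hk ↦ h.inner_faceRoots_eq_zero (I := {l | l ≠ i ∧ (P.root l, (0 : ℝ)) ∈ S₂})
    (fun hi' ↦ hi'.1 rfl) ?_ ?_ k hk j ⟨hγi, (hmem j hγi).resolve_left hγS⟩⟩
  · rintro l ⟨-, hl⟩
    have : ⟪-P.root (highestRoot b), P.root l⟫_ℝ = 0 := horth _ hθS _ hl
    rwa [inner_neg_left, neg_eq_zero] at this
  · rintro l ⟨-, hl⟩ m hm hmi
    refine horth (P.root m, (0 : ℝ)) ((hmem m hmi).resolve_right fun hm' ↦ hm ⟨hmi, hm'⟩) _ hl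

end Faces

-- Finite intersections of half-spaces.

section HalfSpaces

variable {E : Type*} [NormedAddCommGroup E] [InnerProductSpace ℝ E]

/-- Used to push a boundary point outwards without violating the inequalities that are strict there.
-/
theorem eventually_inner_smul_le {p a : E} {c : ℝ} (h : ⟪p, a⟫_ℝ < c) :
    ∀ᶠ t in nhdsWithin (1 : ℝ) (Set.Ioi 1), ⟪t • p, a⟫_ℝ ≤ c := by
  have hcont : Continuous fun t : ℝ ↦ ⟪t • p, a⟫_ℝ := by fun_prop
  have h1 : ∀ᶠ t in nhds (1 : ℝ), ⟪t • p, a⟫_ℝ < c :=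
    hcont.continuousAt.eventually_lt_const (by simpa using h)
  exact (h1.filter_mono nhdsWithin_le_nhds).mono fun _ ht ↦ ht.le

theorem dense_inner_ne_zero {y : E} (hy : y ≠ 0) : Dense {x : E | ⟪x, y⟫_ℝ ≠ 0} := by
  have h : interior ((LinearMap.ker (innerₗ E y) : Submodule ℝ E) : Set E) = ∅ := by
    by_contra hne
    have htop := Submodule.eq_top_of_nonempty_interior' _ (Set.nonempty_iff_ne_empty.mpr hne)
    have hmem : y ∈ LinearMap.ker (innerₗ E y) := htop ▸ Submodule.mem_top
    exact hy (inner_self_eq_zero (𝕜 := ℝ).mp hmem)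
  rw [interior_eq_empty_iff_dense_compl] at h
  convert h using 1
  ext x
  simp [real_inner_comm]

/-- In a finite intersection of half-spaces, those whose boundary meets the intersection in a set
that spans a proper subspace are redundant. -/
theorem inner_le_of_facets {K : Type*} [Finite K] [CompleteSpace E] {a : K → E} {m : K → ℝ}
    (hm : ∀ k, 0 < m k) {J : Set K}
    (hJ : ∀ k ∉ J, ∃ y : E, y ≠ 0 ∧
      ∀ x, (∀ l, ⟪x, a l⟫_ℝ ≤ m l) → ⟪x, a k⟫_ℝ = m k → ⟪x, y⟫_ℝ = 0)
    {x : E} (hx : ∀ k ∈ J, ⟪x, a k⟫_ℝ ≤ m k) (k : K) : ⟪x, a k⟫_ℝ ≤ m k := by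
  by_contra! hk
  choose! y hy hxy using hJ
  -- A generic point avoids the hyperplanes orthogonal to the `y l`; by Baire these points are
  -- dense.
  have hdense : Dense (⋂ l : {l // l ∉ J}, {z : E | ⟪z, y l⟫_ℝ ≠ 0}) :=
    dense_iInter_of_isOpen
      (fun l ↦ isOpen_ne_fun (by fun_prop) continuous_const) (fun l ↦ dense_inner_ne_zero (hy l l.2))
  set O : Set E := {z | m k < ⟪z, a k⟫_ℝ} ∩ ⋂ l : J, {z | ⟪z, a l⟫_ℝ < m l} with hO
  have hopen : IsOpen O :=
    (isOpen_lt continuous_const (by fun_prop)).inter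
      (isOpen_iInter_of_finite fun l ↦ isOpen_lt (by fun_prop) continuous_const)
  -- Shrinking `x` slightly makes the inequalities in `J` strict, since the `m l` are positive,
  -- while the one at `k` still fails.
  have hne : O.Nonempty := by
    have hpos := (hm k).trans hk
    obtain ⟨t, ht, ht'⟩ := exists_between ((div_lt_one hpos).mpr hk)
    have ht0 : 0 < t := (div_pos (hm k) hpos).trans ht
    refine ⟨t • x, ?_, Set.mem_iInter.mpr fun l ↦ ?_⟩
    · change m k < ⟪t • x, a k⟫_ℝ
      rw [real_inner_smul_left]
      exact (div_lt_iff₀ hpos).mp ht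
    · change ⟪t • x, a l⟫_ℝ < m l
      rw [real_inner_smul_left]
      calc t * ⟪x, a l⟫_ℝ ≤ t * m l := mul_le_mul_of_nonneg_left (hx l l.2) ht0.le
        _ < m l := by nlinarith [hm l]
  obtain ⟨z, hz, hzO⟩ := hdense.inter_open_nonempty O hopen hne |>.imp fun _ h ↦ h.symm
  rw [Set.mem_iInter] at hz
  obtain ⟨hzk, hzJ⟩ := hzO
  rw [Set.mem_iInter] at hzJ
  have : Nonempty K := ⟨k⟩
  -- Dividing `z` by the largest ratio `s` puts it in the intersection, on the boundary of `l`. As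
  -- `s > 1`, `l` is outside `J`, so `z` is orthogonal to `y l`, against genericity.
  obtain ⟨l, hl⟩ := Finite.exists_max fun l ↦ ⟪z, a l⟫_ℝ / m l
  set s := ⟪z, a l⟫_ℝ / m l with hs
  have hs1 : 1 < s := ((one_lt_div (hm k)).mpr hzk).trans_le (hl k)
  have hs0 : 0 < s := one_pos.trans hs1
  by_cases hlJ : l ∈ J
  · exact absurd ((div_lt_one (hm l)).mpr (hzJ ⟨l, hlJ⟩)) (not_lt.mpr hs1.le)
  · have h1 := hxy l hlJ (s⁻¹ • z) (fun l' ↦ ?_) ?_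
    · rw [real_inner_smul_left] at h1
      exact hz ⟨l, hlJ⟩ ((mul_eq_zero.mp h1).resolve_left (inv_pos.mpr hs0).ne')
    · rw [real_inner_smul_left, inv_mul_le_iff₀ hs0, ← div_le_iff₀ (hm l')]
      exact hl l'
    · rw [real_inner_smul_left, inv_mul_eq_iff_eq_mul₀ hs0.ne', hs,
        div_mul_cancel₀ _ (hm l).ne']

end HalfSpaces

-- Facets of the root polytope and their coweight normals.

section Facets

variable {ι E N : Type*} [NormedAddCommGroup E] [InnerProductSpace ℝ E]
  [AddCommGroup N] [Module ℝ N] {P : RootPairing ι ℝ E N}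
  [Finite ι] [P.IsCrystallographic] [P.IsReduced] [P.IsRootSystem] [P.IsIrreducible]

open RootPairing

/-- A linear form that vanishes at the roots of a face vanishes on the face. -/
theorem IsInvariant.inner_eq_zero_of_face (h : IsInvariant P) {b : P.Base} {i : b.support} {y : E}
    (hy : ∀ k ∈ faceRoots b i, ⟪P.root k, y⟫_ℝ = 0) (w : P.weylGroup) {x : E}
    (hx : x ∈ rootPolytope P) (hxi : ⟪x, w • fundamentalCoweight b i⟫_ℝ = mark b i) :
    ⟪x, w • y⟫_ℝ = 0 := by
  have hsub : rootPolytope P ⊆ {x | ⟪x, w • fundamentalCoweight b i⟫_ℝ ≤ mark b i ∧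
      (⟪x, w • fundamentalCoweight b i⟫_ℝ = mark b i → ⟪x, w • y⟫_ℝ = 0)} := by
    refine convexHull_min ?_ ?_
    · rintro _ ⟨j, rfl⟩
      rw [Set.mem_ofPred_eq, h.inner_smul_right, h.inner_smul_right, weylGroup_apply_root]
      exact ⟨inner_root_le_mark b _ i, fun hj ↦ hy _ hj⟩
    · rw [convex_iff_forall_pos]
      rintro u ⟨hu, hu'⟩ v ⟨hv, hv'⟩ s t hs ht hst
      simp only [Set.mem_ofPred_eq, inner_add_left, real_inner_smul_left]
      have h1 := mul_le_mul_of_nonneg_left hu hs.le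
      have h2 := mul_le_mul_of_nonneg_left hv ht.le
      have h3 : s * mark b i + t * mark b i = mark b i := by rw [← add_mul, hst, one_mul]
      refine ⟨by linarith, fun heq ↦ ?_⟩
      -- Both weights are positive, so equality at the combination forces equality at both ends.
      have h4 : s * ⟪u, w • fundamentalCoweight b i⟫_ℝ = s * mark b i := by linarith
      have h5 : t * ⟪v, w • fundamentalCoweight b i⟫_ℝ = t * mark b i := by linarith
      rw [hu' (mul_left_cancel₀ hs.ne' h4), hv' (mul_left_cancel₀ ht.ne' h5)]
      simp
  exact (hsub hx).2 hxi

/-- The inequalities with index in `facetIndices` define the root polytope. -/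
theorem IsInvariant.rootPolytope_eq_facets (h : IsInvariant P) (b : P.Base) :
    rootPolytope P = {x : E | ∀ i ∈ facetIndices b, ∀ w : P.weylGroup,
      ⟪x, w • fundamentalCoweight b i⟫_ℝ ≤ mark b i} := by
  have : FiniteDimensional ℝ E := b.toWeightBasis.finiteDimensional_of_finite
  have : CompleteSpace E := FiniteDimensional.complete ℝ E
  have := weylGroup_finite (P := P)
  apply Set.Subset.antisymm
  · intro x hx i _ w
    exact h.rootPolytope_subset b hx w i
  · intro x hx
    rw [h.rootPolytope_eq b]
    intro w i
    refine inner_le_of_facets (K := b.support × P.weylGroup)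
      (a := fun k ↦ k.2 • fundamentalCoweight b k.1) (m := fun k ↦ mark b k.1)
      (fun k ↦ mark_pos b k.1) (J := {k | k.1 ∈ facetIndices b}) ?_ (fun k hk ↦ hx k.1 hk k.2)
      (i, w)
    rintro ⟨j, v⟩ hj
    obtain ⟨k, hk⟩ := h.exists_inner_faceRoots_eq_zero hj
    refine ⟨v • P.root k, ?_, fun z hz hzj ↦ h.inner_eq_zero_of_face hk v ?_ hzj⟩
    · rw [weylGroup_apply_root]
      exact P.ne_zero _
    · rw [h.rootPolytope_eq b]
      exact fun v' j' ↦ hz (j', v')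

/-- A facet has a point at which only the inequality of the facet is an equality. -/
theorem IsInvariant.exists_mem_facet (h : IsInvariant P) {b : P.Base} {i : b.support}
    (hi : i ∈ facetIndices b) (w : P.weylGroup) :
    ∃ p ∈ rootPolytope P, ⟪p, w • fundamentalCoweight b i⟫_ℝ = mark b i ∧
      ∀ (a : E) (c : ℝ), (∀ x ∈ rootPolytope P, ⟪x, a⟫_ℝ ≤ c) → ⟪p, a⟫_ℝ = c →
        a = (c / mark b i) • w • fundamentalCoweight b i := by
  classical
  have := Fintype.ofFinite ι
  set V : Finset ι := {k | k ∈ faceRoots b i} with hV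
  have hVmem : ∀ k, k ∈ V ↔ k ∈ faceRoots b i := by simp [hV]
  have hVne : V.Nonempty := ⟨_, (hVmem _).mpr (highestRoot_mem_faceRoots b i)⟩
  have hcard : (0 : ℝ) < V.card := by exact_mod_cast hVne.card_pos
  have hinner : ∀ a : E, ⟪∑ k ∈ V, (V.card : ℝ)⁻¹ • w • P.root k, a⟫_ℝ =
      (V.card : ℝ)⁻¹ * ∑ k ∈ V, ⟪w • P.root k, a⟫_ℝ := fun a ↦ by
    simp_rw [sum_inner, real_inner_smul_left, Finset.mul_sum]
  have hmem : ∀ k, w • P.root k ∈ rootPolytope P := fun k ↦ by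
    rw [weylGroup_apply_root]
    exact subset_convexHull ℝ _ ⟨_, rfl⟩
  -- The witness is the barycentre of the face's roots, moved by `w`.
  refine ⟨∑ k ∈ V, (V.card : ℝ)⁻¹ • w • P.root k, ?_, ?_, fun a c ha hpa ↦ ?_⟩
  · refine (convex_convexHull ℝ _).sum_mem (fun _ _ ↦ by positivity) ?_ (fun k _ ↦ hmem k)
    rw [Finset.sum_const, nsmul_eq_mul, mul_inv_cancel₀ hcard.ne']
  · rw [hinner, Finset.sum_congr rfl (g := fun _ ↦ mark b i) fun k hk ↦ by
      rw [h.inner_smul_smul]; exact (hVmem k).mp hk]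
    rw [Finset.sum_const, nsmul_eq_mul, inv_mul_cancel_left₀ hcard.ne']
  -- The slacks `c - (w α, a)` are nonnegative with zero sum, so all vanish; the face's roots span
  -- `E` and hence determine `a`.
  · have hsum : ∑ k ∈ V, (c - ⟪w • P.root k, a⟫_ℝ) = 0 := by
      rw [hinner, inv_mul_eq_iff_eq_mul₀ hcard.ne'] at hpa
      rw [Finset.sum_sub_distrib, hpa, Finset.sum_const, nsmul_eq_mul, sub_self]
    rw [Finset.sum_eq_zero_iff_of_nonneg fun k _ ↦ sub_nonneg.mpr (ha _ (hmem k))] at hsum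
    have h0 : w⁻¹ • a - (c / mark b i) • fundamentalCoweight b i = 0 := by
      refine h.eq_zero_of_inner_faceRoots hi fun k hk ↦ ?_
      rw [inner_sub_right, real_inner_smul_right, show ⟪P.root k, _⟫_ℝ = mark b i from hk,
        div_mul_cancel₀ _ (mark_pos b i).ne', ← h.inner_smul_smul w, smul_inv_smul]
      linarith [hsum k ((hVmem k).mpr hk)]
    rw [sub_eq_zero, inv_smul_eq_iff] at h0
    rw [h0, smul_comm]

-- Both coweights are dominant, so the two conjugate points coincide, and pairing with `α_j` gives
-- `j = i`. The stabilizer of `ω_j` is generated by the simple reflections other than `s_j`.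
omit [P.IsIrreducible] in
theorem IsInvariant.eq_of_smul_fundamentalCoweight (h : IsInvariant P) {b : P.Base}
    {i j : b.support} {v w : P.weylGroup} {t : ℝ} (ht : 0 < t)
    (heq : v • fundamentalCoweight b j = t • w • fundamentalCoweight b i) :
    j = i ∧ w⁻¹ * v ∈ parabolicSubgroup b j := by
  classical
  have h1 : (w⁻¹ * v) • fundamentalCoweight b j = t • fundamentalCoweight b i := by
    rw [mul_smul, heq, smul_comm, inv_smul_smul]
  obtain ⟨h2, h3⟩ := h.smul_eq_of_isDominant (w := w⁻¹ * v)
    (isDominant_fundamentalCoweight b j) (fun k ↦ by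
      rw [h1, real_inner_smul_right]
      exact mul_nonneg ht.le (isDominant_fundamentalCoweight b i k))
  constructor
  · rw [h1] at h2
    have h4 := congrArg (fun x ↦ ⟪P.root j, x⟫_ℝ) h2
    simp only [real_inner_smul_right, inner_root_fundamentalCoweight, if_pos] at h4
    by_contra hne
    rw [if_neg hne, mul_zero] at h4
    exact zero_ne_one h4
  · refine Subgroup.closure_mono (Set.image_mono ?_) h3
    rintro k ⟨hk, hk0⟩
    refine ⟨hk, ?_⟩
    rintro rfl
    rw [inner_root_fundamentalCoweight, if_pos rfl] at hk0
    exact one_ne_zero hk0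

omit [P.IsCrystallographic] [P.IsReduced] [P.IsIrreducible] in
theorem IsInvariant.smul_fundamentalCoweight (h : IsInvariant P) {b : P.Base} {i : b.support}
    {w : P.weylGroup} (hw : w ∈ parabolicSubgroup b i) :
    w • fundamentalCoweight b i = fundamentalCoweight b i := by
  classical
  induction hw using Subgroup.closure_induction with
  | mem g hg =>
    obtain ⟨j, ⟨hj, hji⟩, rfl⟩ := hg
    rw [ofIdx_smul_eq_reflection, h.reflection_eq, real_inner_comm,
      inner_root_fundamentalCoweight b ⟨j, hj⟩ i, if_neg fun h' ↦ hji (congrArg Subtype.val h')]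
    simp
  | one => exact one_smul _ _
  | mul x y _ _ hx hy => rw [mul_smul, hy, hx]
  | inv x _ hx => rw [inv_smul_eq_iff, hx]

end Facets

end RootPolytope

end
-- The two descriptions and minimality.
theorem corollary5p5 {ι E N : Type*} [Finite ι]
    [NormedAddCommGroup E] [InnerProductSpace ℝ E] [AddCommGroup N] [Module ℝ N]
    (P : RootPairing ι ℝ E N) [P.IsRootSystem] [P.IsCrystallographic] [P.IsReduced]
    [P.IsIrreducible]
    (hinv : ∀ (i : ι) (x y : E), ⟪P.reflection i x, P.reflection i y⟫_ℝ = ⟪x, y⟫_ℝ)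
    (b : P.Base) :
    rootPolytope P =
        {x : E | ∀ (w : P.weylGroup) (i : b.support),
          ⟪x, w • fundamentalCoweight b i⟫_ℝ ≤ mark b i} ∧
      ∀ L : b.support → Set P.weylGroup,
        (∀ i ∈ facetIndices b,
          Subgroup.IsComplement (L i) (parabolicSubgroup b i : Set P.weylGroup)) →
        rootPolytope P =
            {x : E | ∀ i ∈ facetIndices b, ∀ w ∈ L i,
              ⟪x, w • fundamentalCoweight b i⟫_ℝ ≤ mark b i} ∧
          (∀ i ∈ facetIndices b, ∀ w ∈ L i,
            rootPolytope P ≠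
              {x : E | ∀ j ∈ facetIndices b, ∀ v ∈ L j, (j, v) ≠ (i, w) →
                ⟪x, v • fundamentalCoweight b j⟫_ℝ ≤ mark b j}) ∧
          ∀ F : Set (Set E), F.Finite → (∀ H ∈ F, IsHalfSpace H) → ⋂₀ F = rootPolytope P →
            ∀ i ∈ facetIndices b, ∀ w ∈ L i, coweightHalfSpace b i w ∈ F := by
  have h : IsInvariant P := hinv
  have hfin := weylGroup_finite (P := P)
  refine ⟨h.rootPolytope_eq b, fun L hL ↦ ?_⟩
  have hdist : ∀ i ∈ facetIndices b, ∀ w ∈ L i, ∀ j ∈ facetIndices b, ∀ v ∈ L j, ∀ t : ℝ, 0 < t →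
      v • fundamentalCoweight b j = t • w • fundamentalCoweight b i → (j, v) = (i, w) := by
    intro i hi w hw j hj v hv t ht heq
    obtain ⟨rfl, hmem⟩ := h.eq_of_smul_fundamentalCoweight ht heq
    -- Uniqueness of factorization for `v = v * 1 = w * (w⁻¹ * v)`.
    have := (hL j hj).1 (a₁ := (⟨v, hv⟩, ⟨1, one_mem _⟩)) (a₂ := (⟨w, hw⟩, ⟨_, hmem⟩)) (by simp)
    exact congrArg (Prod.mk j) (congrArg (fun z ↦ (z.1 : P.weylGroup)) this)
  refine ⟨?_, fun i hi w hw heq ↦ ?_, fun F hF hFH hFP i hi w hw ↦ ?_⟩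
  · rw [h.rootPolytope_eq_facets b]
    ext x
    refine ⟨fun hx i hi w _ ↦ hx i hi w, fun hx i hi w ↦ ?_⟩
    obtain ⟨⟨l, g⟩, hlg⟩ := (hL i hi).2 w
    have hg : (g : P.weylGroup) • fundamentalCoweight b i = fundamentalCoweight b i :=
      h.smul_fundamentalCoweight g.2
    rw [← hlg, mul_smul, hg]
    exact hx i hi l l.2
  · obtain ⟨p, hp, hpi, hpu⟩ := h.exists_mem_facet hi w
    -- Every other inequality is strict at `p`, so it survives at `t • p` for `t > 1` close to `1`,
    -- while `t • p` leaves the polytope through the facet `(i, w)`.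
    have hev : ∀ᶠ t in nhdsWithin (1 : ℝ) (Set.Ioi 1), ∀ k : b.support × P.weylGroup,
        k.1 ∈ facetIndices b → k.2 ∈ L k.1 → k ≠ (i, w) →
          ⟪t • p, k.2 • fundamentalCoweight b k.1⟫_ℝ ≤ mark b k.1 := by
      refine Filter.eventually_all.mpr fun ⟨j, v⟩ ↦ ?_
      by_cases hk : j ∈ facetIndices b ∧ v ∈ L j ∧ (j, v) ≠ (i, w)
      · refine (eventually_inner_smul_le (lt_of_le_of_ne (h.rootPolytope_subset b hp v j)
          fun hpj ↦ hk.2.2 ?_)).mono fun t ht _ _ _ ↦ ht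
        exact hdist i hi w hw j hk.1 v hk.2.1 _ (div_pos (mark_pos b j) (mark_pos b i))
          (hpu _ _ (fun x hx ↦ h.rootPolytope_subset b hx v j) hpj)
      · exact Filter.Eventually.of_forall fun t h1 h2 h3 ↦ absurd ⟨h1, h2, h3⟩ hk
    obtain ⟨t, ht, ht1⟩ := (hev.and self_mem_nhdsWithin).exists
    have htp : t • p ∈ rootPolytope P := by
      rw [heq]
      exact fun j hj v hv hne ↦ ht (j, v) hj hv hne
    have := h.rootPolytope_subset b htp w i
    rw [real_inner_smul_left, hpi] at this
    nlinarith [mark_pos b i, (show 1 < t from ht1)]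
  · obtain ⟨p, hp, hpi, hpu⟩ := h.exists_mem_facet hi w
    have hPH : ∀ H ∈ F, rootPolytope P ⊆ H := fun H hH ↦ hFP ▸ Set.sInter_subset_of_mem hH
    -- Some half-space of `F` has `p` on its boundary; otherwise, `F` being finite, `t • p` would
    -- stay in all of them for some `t > 1`.
    obtain ⟨H, hH, a, ha, c, rfl, hpc⟩ : ∃ H ∈ F, ∃ a : E, a ≠ 0 ∧ ∃ c : ℝ,
        H = {x : E | ⟪x, a⟫_ℝ ≤ c} ∧ ⟪p, a⟫_ℝ = c := by
      by_contra! hcon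
      have hev : ∀ᶠ t in nhdsWithin (1 : ℝ) (Set.Ioi 1), ∀ H ∈ F, t • p ∈ H := by
        refine (Filter.eventually_all_finite hF).mpr fun H hH ↦ ?_
        obtain ⟨a, ha, c, rfl⟩ := hFH H hH
        exact eventually_inner_smul_le (lt_of_le_of_ne (hPH _ hH hp) (hcon _ hH a ha c rfl))
      obtain ⟨t, ht, ht1⟩ := (hev.and self_mem_nhdsWithin).exists
      have htp : t • p ∈ rootPolytope P := hFP ▸ Set.mem_sInter.mpr ht
      have := h.rootPolytope_subset b htp w i
      rw [real_inner_smul_left, hpi] at this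
      nlinarith [mark_pos b i, (show 1 < t from ht1)]
    have hac := hpu a c (hPH _ hH) hpc
    -- Symmetry of the polytope gives `-c ≤ c`; as `c = 0` would force `a = 0`, the normal `a` is a
    -- positive multiple of the coweight.
    have hneg : -p ∈ rootPolytope P := by
      have hsub : rootPolytope P ⊆ Neg.neg ⁻¹' rootPolytope P := by
        refine convexHull_min ?_ ?_
        · rintro _ ⟨j, rfl⟩
          exact subset_convexHull ℝ _ ⟨P.reflectionPerm j j, by simp⟩
        · exact (convex_convexHull ℝ _).is_linear_preimage (LinearMap.isLinear (-LinearMap.id))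
      exact hsub hp
    have hc0 : 0 < c := by
      have h1 : ⟪-p, a⟫_ℝ ≤ c := hPH _ hH hneg
      rw [inner_neg_left, hpc] at h1
      refine lt_of_le_of_ne (by linarith) fun hc ↦ ha ?_
      rw [hac, ← hc, zero_div, zero_smul]
    convert hH using 1
    ext x
    change ⟪x, w • fundamentalCoweight b i⟫_ℝ ≤ mark b i ↔ ⟪x, a⟫_ℝ ≤ c
    rw [hac, real_inner_smul_right, div_mul_eq_mul_div, div_le_iff₀ (mark_pos b i),
      mul_le_mul_iff_of_pos_left hc0]
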